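/- **Setting.** Let $\Sigma$ be a relational alphabet: finitely many relation symbols with arities, divided into state relations and action relations, and a (possibly infinite) set $D$ of constants; variables come from a countably infinite set. A *ground state* is any set of ground state atoms; $I^\Sigma$ is the set of ground states. An *abstract state* is a set of state atoms whose arguments are variables or constants. For abstract states, $C\preceq C'$ ($C$ is OI-subsumed by $C'$) means that there is a substitution $\theta$, injective on the terms occurring in $C'$ (constants being fixed), with $C'\theta\subseteq C$. A relational MDP $K$ is a finite set of rules $H\xleftarrow{p:A}B$ ($H,B$ finite sets of state atoms, $A$ an action atom, $p\in[0,1]$). Its ground MDP $M$ has state space $I^\Sigma$ and the ground action atoms as actions: a grounding $\theta$ of a rule's variables that is injective on the terms of the rule and satisfies $B\theta\subseteq s$ contributes probability $p$ to the transition from $s$ to $(s\setminus B\theta)\cup H\theta$ under $A\theta$; an action is enabled in $s$ iff these contributions sum to $1$. A policy $\pi$ chooses, at random and depending on the history, an enabled action (the process ends in a state iff no action is enabled there, and is then treated as staying in it); $P^\pi_{M}$ is the induced measure on paths, and $P^{\max}_M=\sup_\pi P^\pi_M$. $L^{FG}$ consists of the formulae $\Psi=\mathsf P_{\ge\alpha}\Phi$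 with $\alpha\in[0,1]$, $\Phi=\mathsf F^{\le k}\varphi$ or $\Phi=\mathsf G^{\le k}\varphi$, $k\in\mathbb N$ and $\varphi$ a nonempty finite conjunction of state atoms. For a substitution $\theta$ grounding the variables of $\varphi$ and injective on the terms of $\varphi$, a path $\sigma=s_0s_1\dots$ satisfies $\mathsf F^{\le k}\varphi$ (resp. $\mathsf G^{\le k}\varphi$) under $\theta$ iff $\varphi\theta\subseteq s_i$ for some (resp. every) $i\le k$. In the policy-agnostic case $s\models\Psi$ means that for some such $\theta$ the value $P^{\max}_M$ of the set of paths from $s$ satisfying $\Phi$ under $\theta$ is at least $\alpha$; in the policy-specific case (operator $\mathsf P^\pi_{\ge\alpha}$ for a given $\pi$) $P^{\max}_M$ is replaced by $P^\pi_M$. Put $\mathrm{Mod}(\Psi)=\{s\in I^\Sigma: s\models\Psi\}$ and write $\Psi\preceq_{FG}\Psi'$ iff $\mathrm{Mod}(\Psi)\subseteq\mathrm{Mod}(\Psi')$. A set $\mathcal S$ of abstract states *represents* $\mathrm{Mod}(\Psi)$ if for all $s\in I^\Sigma$: $s\in\mathrm{Mod}(\Psi)\iff\exists C\in\mathcal S,\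 s\preceq C$. Let $Sat_K(\Psi)$ be the set of abstract states satisfying $\Psi$, i.e. of all $C$ such that every $s\in I^\Sigma$ with $s\preceq C$ satisfies $\Psi$; it is the largest set representing $\mathrm{Mod}(\Psi)$ whenever some set represents $\mathrm{Mod}(\Psi)$. **Theorem.** Let $\Psi,\Psi'\in L^{FG}$ with $\Psi\preceq_{FG}\Psi'$. Then $Sat_K(\Psi)\subseteq Sat_K(\Psi')$. If moreover $D$ is infinite, $\mathcal S$ is a set of finite abstract states that represents $\mathrm{Mod}(\Psi)$, and $\mathcal S'$ is a finite set of finite abstract states that represents $\mathrm{Mod}(\Psi')$, then also $\{C:\exists C_0\in\mathcal S,\ C\preceq C_0\}\subseteq\{C:\exists C_0\in\mathcal S',\ C\preceq C_0\}$. Both claims hold in the policy-agnostic case (operator $\mathsf P_{\ge\alpha}$) and, for every policy $\pi$, in the policy-specific case (operator $\mathsf P^\pi_{\ge\alpha}$, with $\preceq_{FG}$, $\mathrm{Mod}$ and $Sat_K$ taken with respect to $\pi$). -/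

import Mathlib

open MeasureTheory ProbabilityTheory
open scoped ENNReal NNReal

namespace RelPCTL

universe u v

/-! ### Relational logic -/

/-- A relational alphabet: finitely many relation symbols, divided into state relations and action
relations, each with an arity, and a (possibly infinite) domain of constants. -/
structure Alphabet where
  StateRel : Type u
  ActRel : Type u
  Dom : Type v
  stateArity : StateRel → ℕ
  actArity : ActRel → ℕ
  finiteStateRel : Finite StateRel
  finiteActRel : Finite ActRel

/-- Terms: variables (from the countably infinite set `ℕ`) or constants from `D`. -/
inductive Term (D : Type v) : Type v
  | var (X : ℕ) : Term D
  | const (c : D) : Term D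

/-- An atom `r(t₁, …, tₘ)` whose arguments are taken from `T` (terms, or just constants). -/
structure Atom {R : Type u} (ar : R → ℕ) (T : Type v) where
  rel : R
  args : Fin (ar rel) → T

/-- Apply a function to every argument of an atom. -/
def Atom.map {R : Type u} {ar : R → ℕ} {T : Type v} {T' : Type v} (f : T → T') (a : Atom ar T) :
    Atom ar T' :=
  ⟨a.rel, fun i => f (a.args i)⟩

/-- A substitution, as a map from variables to terms (unbound variables are mapped to
themselves). -/
abbrev Subst (D : Type v) := ℕ → Term D

/-- Application of a substitution to a term. -/
def Term.subst {D : Type v} (θ : Subst D) : Term D → Term D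
  | .var X => θ X
  | .const c => .const c

/-- Application of a substitution to an atom. -/
def Atom.subst {R : Type u} {ar : R → ℕ} {D : Type v} (θ : Subst D) (a : Atom ar (Term D)) :
    Atom ar (Term D) :=
  a.map (Term.subst θ)

/-- A ground atom, seen as an atom over terms. -/
def Atom.toTerm {R : Type u} {ar : R → ℕ} {D : Type v} (a : Atom ar D) : Atom ar (Term D) :=
  a.map Term.const

/-- The terms occurring in a set of atoms. -/
def termsOf {R : Type u} {ar : R → ℕ} {D : Type v} (C : Set (Atom ar (Term D))) : Set (Term D) :=
  {t | ∃ a ∈ C, ∃ i, a.args i = t}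

/-- `θ` respects object identity on a set of terms: different terms stay different. -/
def ObjectIdentity {D : Type v} (θ : Subst D) (T : Set (Term D)) : Prop :=
  Set.InjOn (Term.subst θ) T

/-- `θ` binds exactly the variables occurring in `T`, and binds each of them to a constant. -/
def IsGrounding {D : Type v} (θ : Subst D) (T : Set (Term D)) : Prop :=
  (∀ X, Term.var X ∈ T → ∃ c, θ X = Term.const c) ∧ (∀ X, Term.var X ∉ T → θ X = Term.var X)

section Logic

variable (𝔸 : Alphabet.{u, v})

/-- The (partially ground) atoms over the state relations. -/
abbrev StateAtom := Atom 𝔸.stateArity (Term 𝔸.Dom)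

/-- The Herbrand base: ground atoms over the state relations. -/
abbrev GroundAtom := Atom 𝔸.stateArity 𝔸.Dom

/-- (Abstract) action atoms. -/
abbrev ActAtom := Atom 𝔸.actArity (Term 𝔸.Dom)

/-- Ground actions. -/
abbrev GroundAct := Atom 𝔸.actArity 𝔸.Dom

/-- Ground states: Herbrand interpretations over the state relations. -/
abbrev State := Set (GroundAtom 𝔸)

/-- Abstract states: conjunctions, i.e. sets of atoms. -/
abbrev AbstractState := Set (StateAtom 𝔸)

end Logic

variable {𝔸 : Alphabet.{u, v}}

/-- A ground state as a conjunction. -/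
def conj (s : State 𝔸) : AbstractState 𝔸 := Atom.toTerm '' s

/-- `C ⪯ C'`: the conjunction `C` is OI-subsumed by `C'`, i.e. `C'θ ⊆ C` for some substitution `θ`
that respects object identity on `C'`. -/
def SubsumedBy (C C' : AbstractState 𝔸) : Prop :=
  ∃ θ : Subst 𝔸.Dom, ObjectIdentity θ (termsOf C') ∧ Atom.subst θ '' C' ⊆ C

/-! ### Markov decision processes -/

/-- A (non-rewarding) MDP: for each state and action the transition probabilities sum to `1`
(the action is enabled in the state) or to `0` (it is not). -/
structure MDP (S : Type u) (A : Type v) where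
  T : S → A → S → ℝ≥0∞
  sum_eq : ∀ s a, ∑' s', T s a s' = 0 ∨ ∑' s', T s a s' = 1

namespace MDP

variable {S : Type u} {A : Type v} (M : MDP S A)

/-- The action `a` is enabled in the state `s`. -/
def Enabled (s : S) (a : A) : Prop := ∑' s', M.T s a s' = 1

open Classical in
/-- The law of the next state when `a` is executed in `s` (only relevant if `a` is enabled). -/
noncomputable def law (s : S) (a : A) : PMF S :=
  if h : M.Enabled s a then ⟨M.T s a, h ▸ ENNReal.summable.hasSum⟩ else PMF.pure s

/-- Histories `s₀, …, sₙ`. They carry the discrete σ-algebra. -/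
def Hist (S : Type u) (n : ℕ) : Type u := Fin (n + 1) → S

instance (n : ℕ) : MeasurableSpace (Hist S n) := ⊤

/-- The current state of a history. -/
def Hist.last {n : ℕ} (h : Hist S n) : S := h (Fin.last n)

/-- The history that consists of the start state only. -/
def Hist.init (s : S) : Hist S 0 := fun _ => s

/-- Append a state to a history. -/
def Hist.snoc {n : ℕ} (h : Hist S n) (s : S) : Hist S (n + 1) := Fin.snoc (α := fun _ => S) h s

/-- A stochastic history-dependent policy. After each history it chooses an enabled action at
random; the value `none` (no action, the process has come to an end) is only taken
if no action is enabled. -/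
structure Policy where
  choice : (n : ℕ) → Hist S n → PMF (Option A)
  enabled_of_mem : ∀ n h a, some a ∈ (choice n h).support → M.Enabled h.last a
  none_of_mem : ∀ n h, none ∈ (choice n h).support → ∀ a, ¬ M.Enabled h.last a

variable {M}

namespace Policy

variable (π : M.Policy)

/-- The law of the next state after a history. A process that has come to an end stays in its
state; for "reach within k steps" and "invariant for k steps" this agrees with
considering finite paths. -/
noncomputable def nextLaw (n : ℕ) (h : Hist S n) : PMF S :=
  (π.choice n h).bind fun o =>
    match o with
    | some a => M.law h.last a
    | none => PMF.pure h.last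

/-- The history after `n + 1` steps, given the histories after `0, …, n` steps. -/
noncomputable def kernel (n : ℕ) :
    Kernel ((i : Finset.Iic n) → Hist S i) (Hist S (n + 1)) where
  toFun x :=
    ((π.nextLaw n (x ⟨n, Finset.mem_Iic.2 le_rfl⟩)).map
      (Hist.snoc (x ⟨n, Finset.mem_Iic.2 le_rfl⟩))).toMeasure
  measurable' :=
    (measurable_from_top (f := fun h : Hist S n =>
      ((π.nextLaw n h).map (Hist.snoc h)).toMeasure)).comp
      (measurable_pi_apply (⟨n, Finset.mem_Iic.2 le_rfl⟩ : Finset.Iic n))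

instance (n : ℕ) : IsMarkovKernel (π.kernel n) :=
  ⟨fun x => by
    change IsProbabilityMeasure (PMF.toMeasure _)
    infer_instance⟩

/-- The family of histories up to time `0` of the process started in `s`. -/
def startHist (s : S) : (i : Finset.Iic 0) → Hist S i
  | ⟨0, _⟩ => Hist.init s
  | ⟨_ + 1, h⟩ => absurd (Finset.mem_Iic.1 h) (by omega)

/-- The probability, under the policy `π`, that the infinite path `s₀, s₁, …` of the process
started in `s` belongs to `Γ` (Ionescu-Tulcea measure on the sequences of histories, of which the
path consists of the current states). -/
noncomputable def prob (s : S) (Γ : Set (ℕ → S)) : ℝ≥0∞ :=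
  Kernel.traj (X := Hist S) π.kernel 0 (startHist s) {ω | (fun n => (ω n).last) ∈ Γ}

end Policy

variable (M) in
/-- The maximal probability of `Γ` over all policies. -/
noncomputable def maxProb (s : S) (Γ : Set (ℕ → S)) : ℝ≥0∞ := ⨆ π : M.Policy, π.prob s Γ

end MDP

/-! ### Relational MDPs -/

/-- An abstract transition rule `head ←[prob : act] body`. -/
structure Rule (𝔸 : Alphabet.{u, v}) where
  head : Finset (StateAtom 𝔸)
  prob : ℝ≥0
  act : ActAtom 𝔸
  body : Finset (StateAtom 𝔸)
  prob_le_one : prob ≤ 1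

namespace Rule

variable (δ : Rule 𝔸)

/-- The terms that occur in a rule. -/
def terms : Set (Term 𝔸.Dom) :=
  termsOf (δ.head : Set (StateAtom 𝔸)) ∪ termsOf (δ.body : Set (StateAtom 𝔸)) ∪
    Set.range δ.act.args

/-- The ground instance `δθ` of the rule `δ` applies to the state `s` and the ground action `a`. -/
def Fires (θ : Subst 𝔸.Dom) (s : State 𝔸) (a : GroundAct 𝔸) : Prop :=
  IsGrounding θ δ.terms ∧ ObjectIdentity θ δ.terms ∧
    Atom.subst θ '' (δ.body : Set (StateAtom 𝔸)) ⊆ conj s ∧ δ.act.subst θ = a.toTerm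

/-- The successor state `(s \ bodyθ) ∪ headθ`. -/
def succ (θ : Subst 𝔸.Dom) (s : State 𝔸) : State 𝔸 :=
  {g | (g ∈ s ∧ g.toTerm ∉ Atom.subst θ '' (δ.body : Set (StateAtom 𝔸))) ∨
    g.toTerm ∈ Atom.subst θ '' (δ.head : Set (StateAtom 𝔸))}

end Rule

/-- A relational MDP over the alphabet `𝔸`: a finite set of transition rules. -/
structure RMDP (𝔸 : Alphabet.{u, v}) where
  rules : Finset (Rule 𝔸)

namespace RMDP

variable (K : RMDP 𝔸)

/-- The total probability of the ground rule instances that lead from `s` to `s'` by `a`. -/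
noncomputable def ruleProb (s : State 𝔸) (a : GroundAct 𝔸) (s' : State 𝔸) : ℝ≥0∞ :=
  ∑ δ ∈ K.rules, ∑' _ : {θ : Subst 𝔸.Dom // δ.Fires θ s a ∧ δ.succ θ s = s'}, (δ.prob : ℝ≥0∞)

open Classical in
/-- The underlying ground MDP. The action `a` is enabled in `s` iff the rule instances that apply
to them have total probability `1`; if the rules are well-formed, this means that some rule
instance applies. -/
noncomputable def ground : MDP (State 𝔸) (GroundAct 𝔸) where
  T s a s' := if ∑' s'', K.ruleProb s a s'' = 1 then K.ruleProb s a s' else 0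
  sum_eq s a := by
    by_cases h : ∑' s'', K.ruleProb s a s'' = 1 <;> simp [h]

end RMDP

/-! ### The language `L^FG` and its semantics -/

/-- State formulae: nonempty conjunctions of atoms. -/
inductive StateFormula (𝔸 : Alphabet.{u, v}) : Type (max u v)
  | atom (a : StateAtom 𝔸) : StateFormula 𝔸
  | and (φ φ' : StateFormula 𝔸) : StateFormula 𝔸

/-- Path formulae `F^{≤k} φ` and `G^{≤k} φ`. -/
inductive PathFormula (𝔸 : Alphabet.{u, v}) : Type (max u v)
  | finally (k : ℕ) (φ : StateFormula 𝔸) : PathFormula 𝔸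
  | globally (k : ℕ) (φ : StateFormula 𝔸) : PathFormula 𝔸

/-- Formulae `P_{≥α} Φ` with `α ∈ [0,1]`. -/
structure Formula (𝔸 : Alphabet.{u, v}) where
  α : Set.Icc (0 : ℝ) 1
  path : PathFormula 𝔸

/-- The set of atoms of a state formula. -/
def StateFormula.atoms : StateFormula 𝔸 → AbstractState 𝔸
  | .atom a => {a}
  | .and φ φ' => φ.atoms ∪ φ'.atoms

/-- The terms that occur in a formula. -/
def PathFormula.terms : PathFormula 𝔸 → Set (Term 𝔸.Dom)
  | .finally _ φ => termsOf φ.atoms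
  | .globally _ φ => termsOf φ.atoms

/-- `s ⊨^θ φ` for state formulae. -/
def StateFormula.Holds (θ : Subst 𝔸.Dom) (s : State 𝔸) : StateFormula 𝔸 → Prop
  | .atom a => a.subst θ ∈ conj s
  | .and φ φ' => φ.Holds θ s ∧ φ'.Holds θ s

/-- The step-bounded until operator `P U^{≤k} Q` on paths (positions are counted from `0`). -/
def UntilLE {S : Type*} (k : ℕ) (P Q : S → Prop) (σ : ℕ → S) : Prop :=
  ∃ i ≤ k, Q (σ i) ∧ ∀ j < i, P (σ j)

/-- `σ ⊨^θ Φ` for path formulae: `F^{≤k} φ` is `⊤ U^{≤k} φ`, and `G^{≤k} φ` is `¬ F^{≤k} ¬ φ`. -/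
def PathFormula.Holds (θ : Subst 𝔸.Dom) (σ : ℕ → State 𝔸) : PathFormula 𝔸 → Prop
  | .finally k φ => UntilLE k (fun _ => True) (fun s => φ.Holds θ s) σ
  | .globally k φ => ¬ UntilLE k (fun _ => True) (fun s => ¬ φ.Holds θ s) σ

/-- `s ⊨ Ψ`, where `P s Γ` is the probability given to the set `Γ` of paths from `s`: there is a
substitution `θ`, grounding the variables of `Ψ` and respecting object identity, for which
the probability of `{σ | σ ⊨^θ Φ}` is at least `α`. -/
def Formula.HoldsWith (P : State 𝔸 → Set (ℕ → State 𝔸) → ℝ≥0∞) (s : State 𝔸) (Ψ : Formula 𝔸) :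
    Prop :=
  ∃ θ : Subst 𝔸.Dom, IsGrounding θ Ψ.path.terms ∧ ObjectIdentity θ Ψ.path.terms ∧
    ENNReal.ofReal (Ψ.α : ℝ) ≤ P s {σ | Ψ.path.Holds θ σ}

namespace RMDP

variable (K : RMDP 𝔸)

/-- `Mod(Ψ) = Sat_M(Ψ)` for the policy-agnostic operator `P_{≥α}`. -/
def Mod (Ψ : Formula 𝔸) : Set (State 𝔸) :=
  {s | Ψ.HoldsWith K.ground.maxProb s}

/-- `Mod(Ψ) = Sat^π_M(Ψ)` for the policy-specific operator `P^π_{≥α}`. -/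
def ModPolicy (π : K.ground.Policy) (Ψ : Formula 𝔸) : Set (State 𝔸) :=
  {s | Ψ.HoldsWith π.prob s}

/-- `Ψ ⪯_FG Ψ'` in the policy-agnostic case. -/
def PrecFG (Ψ Ψ' : Formula 𝔸) : Prop := K.Mod Ψ ⊆ K.Mod Ψ'

/-- `Ψ ⪯_FG Ψ'` in the policy-specific case. -/
def PrecFGPolicy (π : K.ground.Policy) (Ψ Ψ' : Formula 𝔸) : Prop :=
  K.ModPolicy π Ψ ⊆ K.ModPolicy π Ψ'

end RMDP

/-! ### Sets of abstract states -/

/-- The set `𝒮` of abstract states represents the set `X` of ground states: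
`s ∈ X ↔ ∃ s_a ∈ 𝒮, s ⪯ s_a`. -/
def Represents (𝒮 : Set (AbstractState 𝔸)) (X : Set (State 𝔸)) : Prop :=
  ∀ s : State 𝔸, s ∈ X ↔ ∃ C ∈ 𝒮, SubsumedBy (conj s) C

/-- The closure of a set of abstract states under specialization. -/
def specializations (𝒮 : Set (AbstractState 𝔸)) : Set (AbstractState 𝔸) :=
  {C | ∃ C' ∈ 𝒮, SubsumedBy C C'}

/-- The abstract states all of whose ground states belong to `X`. -/
def liftSat (X : Set (State 𝔸)) : Set (AbstractState 𝔸) :=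
  {C | ∀ s : State 𝔸, SubsumedBy (conj s) C → s ∈ X}

/-- If `X` is represented by some set of abstract states at all, then `liftSat X` is the largest
set of abstract states that represents `X`. -/
theorem isGreatest_liftSat {𝒮 : Set (AbstractState 𝔸)} {X : Set (State 𝔸)}
    (h : Represents 𝒮 X) : IsGreatest {𝒯 | Represents 𝒯 X} (liftSat X) := by
  have key : ∀ {𝒯 : Set (AbstractState 𝔸)}, Represents 𝒯 X → 𝒯 ⊆ liftSat X :=
    fun h𝒯 C hC s hs => (h𝒯 s).2 ⟨C, hC, hs⟩
  refine ⟨fun s => ⟨fun hs => ?_, fun ⟨C, hC, hs⟩ => hC s hs⟩, fun 𝒯 h𝒯 => key h𝒯⟩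
  obtain ⟨C, hC, hsC⟩ := (h s).1 hs
  exact ⟨C, key h hC, hsC⟩

namespace RMDP

variable (K : RMDP 𝔸)

/-- `Sat_K(Ψ)`: the abstract states that satisfy `Ψ` (policy-agnostic case). -/
def SatK (Ψ : Formula 𝔸) : Set (AbstractState 𝔸) := liftSat (K.Mod Ψ)

/-- `Sat^π_K(Ψ)`: the abstract states that satisfy `Ψ` (policy-specific case). -/
def SatKPolicy (π : K.ground.Policy) (Ψ : Formula 𝔸) : Set (AbstractState 𝔸) :=
  liftSat (K.ModPolicy π Ψ)

end RMDP

end RelPCTL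

namespace RelPCTL

universe u v

/-! ### Terms, their constants, and trading variables for fresh constants. -/

section Atoms

variable {R : Type u} {ar : R → ℕ} {D : Type v}

/-! Both claims depend only on the inclusion of the two sets of ground states; probabilities and
policies play no further role. The first claim is the monotonicity of `liftSat`. For the second, let
`C ⪯ C₀` with `C₀ ∈ 𝒮`. Replace the variables of `C₀` by distinct constants that occur neither in
`C₀` nor in any member of `𝒮'`. The resulting ground state lies in the smaller set, hence in the
larger one, and so is subsumed by some `C' ∈ 𝒮'`. Since the new constants are foreign to `C₀` and
`C'`, they behave like variables: turning them back gives `C₀ ⪯ C'` (`SubsumedBy.of_groundState`),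
and transitivity gives `C ⪯ C'`. -/

theorem Atom.map_congr {T T' : Type v} {f g : T → T'} {a : Atom ar T}
    (h : ∀ i, f (a.args i) = g (a.args i)) : a.map f = a.map g := by
  simp only [Atom.map, h]

theorem Atom.map_eq_self {T : Type v} {f : T → T} {a : Atom ar T}
    (h : ∀ i, f (a.args i) = a.args i) : a.map f = a := by
  simp only [Atom.map, h]

theorem mem_termsOf {C : Set (Atom ar (Term D))} {a : Atom ar (Term D)} (ha : a ∈ C)
    (i : Fin (ar a.rel)) : a.args i ∈ termsOf C :=
  ⟨a, ha, i, rfl⟩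

theorem finite_termsOf {C : Set (Atom ar (Term D))} (hC : C.Finite) : (termsOf C).Finite := by
  have h : termsOf C = ⋃ a ∈ C, Set.range a.args := by
    ext t
    simp [termsOf]
  rw [h]
  exact hC.biUnion fun a _ => Set.finite_range a.args

/-- If `Cθ ⊆ C'`, then `θ` maps the terms of `C` to terms of `C'`. -/
theorem subst_mem_termsOf {θ : Subst D} {C C' : Set (Atom ar (Term D))}
    (h : Atom.subst θ '' C ⊆ C') {t : Term D} (ht : t ∈ termsOf C) :
    t.subst θ ∈ termsOf C' := by
  obtain ⟨a, ha, i, rfl⟩ := ht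
  exact mem_termsOf (h ⟨a, ha, rfl⟩) i

theorem Term.const_injective : Function.Injective (Term.const : D → Term D) :=
  fun _ _ h => Term.const.inj h

/-- The constants that occur in a set of atoms. -/
def constantsOf (C : Set (Atom ar (Term D))) : Set D := Term.const ⁻¹' termsOf C

theorem finite_constantsOf {C : Set (Atom ar (Term D))} (hC : C.Finite) :
    (constantsOf C).Finite :=
  (finite_termsOf hC).preimage Term.const_injective.injOn

/-- Replace each variable `X` by the constant `g X`. -/
def Term.ground (g : ℕ → D) : Term D → D
  | .var X => g X
  | .const c => c

theorem Term.const_ground (g : ℕ → D) (t : Term D) :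
    Term.const (t.ground g) = t.subst fun X => .const (g X) := by
  cases t <;> rfl

open Classical in
/-- Replace each constant `g X` by the variable `X`. -/
noncomputable def Term.unground (g : ℕ → D) : Term D → Term D
  | .var X => .var X
  | .const c => if h : ∃ X, g X = c then .var h.choose else .const c

theorem Term.unground_apply {g : ℕ → D} (hg : Function.Injective g) (X : ℕ) :
    Term.unground g (.const (g X)) = .var X := by
  have h : ∃ Y, g Y = g X := ⟨X, rfl⟩
  rw [Term.unground, dif_pos h, hg h.choose_spec]

theorem Term.unground_const {g : ℕ → D} {c : D} (hc : ∀ X, g X ≠ c) :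
    Term.unground g (.const c) = .const c :=
  dif_neg fun ⟨X, hX⟩ => hc X hX

/-- On all terms this fails, since `var X` and `const (g X)` have the same image. On constants, the
range of `g` goes injectively to variables and all other constants stay fixed. -/
theorem Term.unground_const_injective {g : ℕ → D} (hg : Function.Injective g) :
    Function.Injective fun c => Term.unground g (.const c) := by
  intro c d h
  by_cases hc : ∃ X, g X = c <;> by_cases hd : ∃ Y, g Y = d
  · obtain ⟨X, rfl⟩ := hc
    obtain ⟨Y, rfl⟩ := hd
    simp only [Term.unground_apply hg, Term.var.injEq] at h
    rw [h]
  · obtain ⟨X, rfl⟩ := hc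
    simp [Term.unground_apply hg, Term.unground_const (not_exists.1 hd)] at h
  · obtain ⟨Y, rfl⟩ := hd
    simp [Term.unground_apply hg, Term.unground_const (not_exists.1 hc)] at h
  · simpa [Term.unground_const (not_exists.1 hc), Term.unground_const (not_exists.1 hd)] using h

/-- The hypothesis is needed because a constant `g X` already present would come back as the
variable `X`. -/
theorem Term.unground_subst {g : ℕ → D} (hg : Function.Injective g) {t : Term D}
    (ht : ∀ X, t ≠ .const (g X)) :
    Term.unground g (t.subst fun X => .const (g X)) = t := by
  cases t with
  | var X => exact Term.unground_apply hg X
  | const c => exact Term.unground_const fun X hX => ht X (congrArg _ hX.symm)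

end Atoms

/-! ### Object-identity subsumption and ground instances. -/

variable {𝔸 : Alphabet.{u, v}}

/-- The substitutions compose. Object identity survives because `η` maps the terms of `C₃` into
those of `C₂`, where `θ` is injective. -/
theorem SubsumedBy.trans {C₁ C₂ C₃ : AbstractState 𝔸} (h₁ : SubsumedBy C₁ C₂)
    (h₂ : SubsumedBy C₂ C₃) : SubsumedBy C₁ C₃ := by
  obtain ⟨θ, hθ, hθC⟩ := h₁
  obtain ⟨η, hη, hηC⟩ := h₂
  have hcomp : ∀ t, Term.subst (fun X => (η X).subst θ) t = (t.subst η).subst θ := by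
    rintro (_ | _) <;> rfl
  refine ⟨fun X => (η X).subst θ, fun t ht t' ht' h => ?_, ?_⟩
  · rw [hcomp, hcomp] at h
    exact hη ht ht' (hθ (subst_mem_termsOf hηC ht) (subst_mem_termsOf hηC ht') h)
  · rintro _ ⟨a, ha, rfl⟩
    have hsubst : a.subst (fun X => (η X).subst θ) = (a.subst η).subst θ :=
      Atom.map_congr (g := Term.subst θ ∘ Term.subst η) fun i => hcomp (a.args i)
    rw [hsubst]
    exact hθC ⟨_, hηC ⟨a, ha, rfl⟩, rfl⟩

/-- The ground state obtained from `C` by replacing each variable `X` by the constant `g X`. -/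
def groundState (g : ℕ → 𝔸.Dom) (C : AbstractState 𝔸) : State 𝔸 :=
  {a | a.toTerm ∈ Atom.subst (fun X => .const (g X)) '' C}

theorem conj_groundState (g : ℕ → 𝔸.Dom) (C : AbstractState 𝔸) :
    conj (groundState g C) = Atom.subst (fun X => .const (g X)) '' C := by
  refine Set.Subset.antisymm (Set.image_subset_iff.2 fun _ h => h) ?_
  rintro _ ⟨a, ha, rfl⟩
  have h : Atom.toTerm (a.map (Term.ground g)) = a.subst fun X => .const (g X) :=
    Atom.map_congr (f := Term.const ∘ Term.ground g) fun i => Term.const_ground g (a.args i)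
  exact ⟨a.map (Term.ground g), ⟨a, ha, h.symm⟩, h⟩

theorem exists_const_of_mem_termsOf_conj {s : State 𝔸} {t : Term 𝔸.Dom}
    (ht : t ∈ termsOf (conj s)) : ∃ c, Term.const c = t := by
  obtain ⟨_, ⟨a, -, rfl⟩, i, rfl⟩ := ht
  exact ⟨a.args i, rfl⟩

/-- Grounding with distinct constants that do not occur in `C` gives a ground state subsumed
by `C`. -/
theorem conj_groundState_subsumedBy {g : ℕ → 𝔸.Dom} (hg : Function.Injective g)
    {C : AbstractState 𝔸} (hC : ∀ X, g X ∉ constantsOf C) :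
    SubsumedBy (conj (groundState g C)) C := by
  refine ⟨fun X => .const (g X), ?_, (conj_groundState g C).ge⟩
  -- Ungrounding is a left inverse of the grounding on the terms of `C`.
  refine Set.LeftInvOn.injOn (f₁' := Term.unground g) fun t ht => ?_
  exact Term.unground_subst hg fun X hX => hC X (show Term.const (g X) ∈ termsOf C from hX ▸ ht)

/-- If `C'` subsumes a grounding of `C` by distinct constants that occur neither in `C` nor in
`C'`, then `C'` subsumes `C`. -/
theorem SubsumedBy.of_groundState {g : ℕ → 𝔸.Dom} (hg : Function.Injective g)
    {C C' : AbstractState 𝔸} (hC : ∀ X, g X ∉ constantsOf C) (hC' : ∀ X, g X ∉ constantsOf C')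
    (h : SubsumedBy (conj (groundState g C)) C') : SubsumedBy C C' := by
  obtain ⟨θ, hθ, hsub⟩ := h
  -- A substitution fixes constants, so "`θ`, then unground" is a substitution on `C'` only if
  -- ungrounding fixes the constants of `C'`; this is where `hC'` enters.
  have hcomp : ∀ t ∈ termsOf C',
      Term.subst (fun X => (θ X).unground g) t = (t.subst θ).unground g := by
    rintro (X | c) ht
    · rfl
    · exact (Term.unground_const (g := g) (c := c) fun X hX =>
        hC' X (show Term.const (g X) ∈ termsOf C' from hX ▸ ht)).symm
  refine ⟨fun X => (θ X).unground g, fun t ht t' ht' h => hθ ht ht' ?_, ?_⟩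
  · rw [hcomp t ht, hcomp t' ht'] at h
    -- `θ` sends the terms of `C'` to terms of a ground state, hence to constants, where ungrounding
    -- is injective.
    obtain ⟨c, hc⟩ := exists_const_of_mem_termsOf_conj (subst_mem_termsOf hsub ht)
    obtain ⟨d, hd⟩ := exists_const_of_mem_termsOf_conj (subst_mem_termsOf hsub ht')
    rw [← hc, ← hd] at h ⊢
    exact congrArg _ (Term.unground_const_injective hg h)
  · rintro _ ⟨a, ha, rfl⟩
    -- The atom `aθ` is the grounding of some `b ∈ C`, and ungrounding recovers `b` because `g`
    -- avoids the constants of `C`.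
    obtain ⟨b, hb, hba⟩ := (conj_groundState g C).le (hsub ⟨a, ha, rfl⟩)
    have hab : a.subst (fun X => (θ X).unground g) = b :=
      calc a.subst (fun X => (θ X).unground g)
          = (a.subst θ).map (Term.unground g) :=
            Atom.map_congr (g := Term.unground g ∘ Term.subst θ) fun i =>
              hcomp _ (mem_termsOf ha i)
        _ = (b.subst fun X => .const (g X)).map (Term.unground g) := by rw [hba]
        _ = b := Atom.map_eq_self (f := Term.unground g ∘ Term.subst fun X => .const (g X))
            fun i => Term.unground_subst hg fun X hX =>
            hC X (show Term.const (g X) ∈ termsOf C from hX ▸ mem_termsOf hb i)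
    rwa [hab]

/-! ### From ground states to sets of abstract states. -/

theorem liftSat_mono {X X' : Set (State 𝔸)} (h : X ⊆ X') : liftSat X ⊆ liftSat X' :=
  fun _ hC s hs => h (hC s hs)

/-- Over an infinite domain, inclusion of sets of ground states passes to the specializations of
representing sets of finite abstract states, if the larger one is finite. -/
theorem specializations_subset [Infinite 𝔸.Dom] {X X' : Set (State 𝔸)} (hX : X ⊆ X')
    {𝒮 𝒮' : Set (AbstractState 𝔸)} (h𝒮 : ∀ C ∈ 𝒮, C.Finite) (h𝒮' : ∀ C ∈ 𝒮', C.Finite)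
    (hfin : 𝒮'.Finite) (hrep : Represents 𝒮 X) (hrep' : Represents 𝒮' X') :
    specializations 𝒮 ⊆ specializations 𝒮' := by
  rintro C ⟨C₀, hC₀, hCC₀⟩
  -- The member `C'` is found only after `g` is fixed, so the constants of all of `𝒮'` must be
  -- avoided in advance; hence the finiteness of `𝒮'`. It is `C₀`, not `C`, that gets grounded: `C`
  -- may be infinite and leave no constant fresh.
  have hF : (constantsOf C₀ ∪ ⋃ C' ∈ 𝒮', constantsOf C').Finite :=
    (finite_constantsOf (h𝒮 C₀ hC₀)).union
      (hfin.biUnion fun C' hC' => finite_constantsOf (h𝒮' C' hC'))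
  let e := hF.infinite_compl.natEmbedding
  let g : ℕ → 𝔸.Dom := fun X => e X
  have hg : Function.Injective g := Subtype.val_injective.comp e.injective
  have hg₀ : ∀ X, g X ∉ constantsOf C₀ := fun X h => (e X).2 (Or.inl h)
  have hg' : ∀ C' ∈ 𝒮', ∀ X, g X ∉ constantsOf C' := fun C' hC' X h =>
    (e X).2 (Or.inr (Set.mem_biUnion hC' h))
  obtain ⟨C', hC', hs⟩ := (hrep' _).1
    (hX ((hrep _).2 ⟨C₀, hC₀, conj_groundState_subsumedBy hg hg₀⟩))
  exact ⟨C', hC', hCC₀.trans (hs.of_groundState hg hg₀ (hg' C' hC'))⟩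

end RelPCTL

open RelPCTL in
theorem mainTheorem2 (𝔸 : Alphabet) (K : RMDP 𝔸) (Ψ Ψ' : Formula 𝔸) :
    (K.PrecFG Ψ Ψ' →
      K.SatK Ψ ⊆ K.SatK Ψ' ∧
      (Infinite 𝔸.Dom → ∀ 𝒮 𝒮' : Set (AbstractState 𝔸),
        (∀ C ∈ 𝒮, C.Finite) → (∀ C ∈ 𝒮', C.Finite) → 𝒮'.Finite →
        Represents 𝒮 (K.Mod Ψ) → Represents 𝒮' (K.Mod Ψ') →
        specializations 𝒮 ⊆ specializations 𝒮')) ∧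
    (∀ π : K.ground.Policy, K.PrecFGPolicy π Ψ Ψ' →
      K.SatKPolicy π Ψ ⊆ K.SatKPolicy π Ψ' ∧
      (Infinite 𝔸.Dom → ∀ 𝒮 𝒮' : Set (AbstractState 𝔸),
        (∀ C ∈ 𝒮, C.Finite) → (∀ C ∈ 𝒮', C.Finite) → 𝒮'.Finite →
        Represents 𝒮 (K.ModPolicy π Ψ) → Represents 𝒮' (K.ModPolicy π Ψ') →
        specializations 𝒮 ⊆ specializations 𝒮')) :=
  -- `PrecFG` and `PrecFGPolicy` both unfold to an inclusion of sets of ground states, so the same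
  -- two lemmas settle both cases.
  ⟨fun h => ⟨liftSat_mono h, fun _ _ _ h𝒮 h𝒮' hfin hrep hrep' =>
      specializations_subset h h𝒮 h𝒮' hfin hrep hrep'⟩,
    fun _ h => ⟨liftSat_mono h, fun _ _ _ h𝒮 h𝒮' hfin hrep hrep' =>
      specializations_subset h h𝒮 h𝒮' hfin hrep hrep'⟩⟩
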